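/- Let $0<r<R<\infty$, $\delta\in\mathbb{R}$ and $\nu\ge|\delta|$. Let $J_\nu$, $Y_\nu$ be the Bessel functions of the first and second kind of order $\nu$ (principal branches), and for $z\in\mathbb{C}\setminus(-\infty,0]$ put $$\widetilde{\mathfrak h}_{\nu,\delta}(z)=J_\nu'(Rz)Y_\nu'(rz)-J_\nu'(rz)Y_\nu'(Rz)+\frac{\delta^2}{Rrz^2}\bigl(J_\nu(Rz)Y_\nu(rz)-J_\nu(rz)Y_\nu(Rz)\bigr)$$ $$\qquad-\frac{\delta}{Rz}\bigl(J_\nu(Rz)Y_\nu'(rz)-J_\nu'(rz)Y_\nu(Rz)\bigr)-\frac{\delta}{rz}\bigl(J_\nu'(Rz)Y_\nu(rz)-J_\nu(rz)Y_\nu'(Rz)\bigr).$$ (For $x>0$ this equals $(Rr)^{\delta}x^{2\delta}\bigl(j'(Rx)y'(rx)-j'(rx)y'(Rx)\bigr)$ with the ultraspherical Bessel functions $j(x)=x^{-\delta}J_\nu(x)$ and $y(x)=x^{-\delta}Y_\nu(x)$.) Then $\widetilde{\mathfrak h}_{\nu,\delta}$ extends by continuity to a function that is holomorphic on $\mathbb{C}\setminus\{0\}$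 and meromorphic on $\mathbb{C}$, and all zeros in $\mathbb{C}$ of this meromorphic function are real and simple. -/

import Mathlib

open Filter Topology

noncomputable section

/-- Bessel function of the first kind `J_ν(z)` (principal branch), by its ascending series
`(z/2)^ν ∑ (-z²/4)^k / (k! Γ(ν+k+1))`. The terms at poles of `Γ` vanish, as they should, since
there `Complex.Gamma` has the value `0`, with inverse `0`. -/
def besselJ (ν z : ℂ) : ℂ :=
  (z / 2) ^ ν * ∑' k : ℕ, (-(z ^ 2 / 4)) ^ k / ((k.factorial : ℂ) * Complex.Gamma (ν + k + 1))

/-- The quotient `(J_ν(z) cos νπ - J_{-ν}(z)) / sin νπ`, meaningful for non-integer `ν`. -/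
def besselYQuot (ν z : ℂ) : ℂ :=
  (besselJ ν z * Complex.cos (ν * Real.pi) - besselJ (-ν) z) / Complex.sin (ν * Real.pi)

open Classical in
/-- Bessel function of the second kind `Y_ν(z)` (principal branch): the quotient above for
non-integer `ν`, and its limiting value in the order for integer `ν`. -/
def besselY (ν z : ℂ) : ℂ :=
  if ∃ n : ℤ, ν = n then limUnder (𝓝[≠] ν) (fun μ => besselYQuot μ z) else besselYQuot ν z

/-- `J_ν(Rz) Y_ν(rz) - J_ν(rz) Y_ν(Rz)`. -/
def crossF (r R ν : ℝ) (z : ℂ) : ℂ :=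
  besselJ ν (R * z) * besselY ν (r * z) - besselJ ν (r * z) * besselY ν (R * z)

/-- `J_ν'(Rz) Y_ν'(rz) - J_ν'(rz) Y_ν'(Rz)`. -/
def crossG (r R ν : ℝ) (z : ℂ) : ℂ :=
  deriv (besselJ ν) (R * z) * deriv (besselY ν) (r * z)
    - deriv (besselJ ν) (r * z) * deriv (besselY ν) (R * z)

/-- The correction term `ℰ_{ν,δ}`. -/
def crossE (r R ν δ : ℝ) (z : ℂ) : ℂ :=
  δ ^ 2 / (R * r * z ^ 2) * crossF r R ν z
    - δ / (R * z) *
      (besselJ ν (R * z) * deriv (besselY ν) (r * z)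
        - deriv (besselJ ν) (r * z) * besselY ν (R * z))
    - δ / (r * z) *
      (deriv (besselJ ν) (R * z) * besselY ν (r * z)
        - besselJ ν (r * z) * deriv (besselY ν) (R * z))

/-- The function `h̃_{ν,δ}` on the complex plane: it is given by `crossG + crossE` on the plane cut
along `(-∞, 0]`, where the principal branches of `J_ν` and `Y_ν` are holomorphic, and is extended
to the cut by continuity. -/
def hTilde (r R ν δ : ℝ) : ℂ → ℂ :=
  extendFrom Complex.slitPlane (fun z => crossG r R ν z + crossE r R ν δ z)

end

/-! With `x = e^t`, Bessel's equation along the ray through `z` becomes `u'' = (ν² - l e^{2t}) u`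
with `l = z²`. Take the combination `u` of `J_ν` and `Y_ν` that satisfies `u' = δ u` at `t = log r`.
The Wronskian gives it the initial value `2/π`, independent of `z`, and `R r z² h̃(z)` is the
boundary defect `u' - δ u` at `t = log R`.

So `z² h̃(z)` depends on `z` only through `z²`. It is therefore even, which extends it across the
cut, and Gronwall bounds it near `0`, which makes the singularity removable.

For the zeros, `((u' - δu) ū)' = |u' - δu|² + (ν² - δ²)|u|² - l e^{2t}|u|²`, and the first two terms
are nonnegative since `|δ| ≤ ν`. Multiplying by `ω = ±i` or `1` and integrating bounds the defect
below by `κ |Im z²|`, and by `κ |z|²` on the imaginary axis, with `κ` uniform on bounded sets. This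
excludes nonreal zeros and a zero at `0`. At a real zero the bound is linear in the distance along
the vertical line, so the zero is simple.

The remaining work shows that `Y_ν` solves the equation with the right Wronskian, also at integer
order, where it is a limit in the order. -/

/-- The entire function `∑ w ^ k / (k! Γ(μ + k + 1))`, so that
`J_μ(z) = (z / 2) ^ μ * besselE μ (-z² / 4)`. -/
noncomputable def besselE (μ w : ℂ) : ℂ :=
  ∑' k : ℕ, w ^ k / ((k.factorial : ℂ) * Complex.Gamma (μ + k + 1))

/-! ### The entire series behind `J_μ`: bounds, recurrence, Wronskian. -/

/-- Compactness handles small `k`, since `1/Γ` is entire. For larger `k`, `1/Γ(s) = s/Γ(s+1)` with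
`|s| ≥ 1` makes the norms nonincreasing in `k`. Uniformity in `μ` is needed for holomorphy and
limits in the order. -/
theorem exists_norm_inv_Gamma_add_nat_le (M : ℝ) :
    ∃ C : ℝ, 0 ≤ C ∧ ∀ μ : ℂ, ‖μ‖ ≤ M → ∀ k : ℕ, ‖(Complex.Gamma (μ + k + 1))⁻¹‖ ≤ C := by
  obtain ⟨N, hN⟩ := exists_nat_ge M
  obtain ⟨C, hC⟩ := (isCompact_closedBall (0 : ℂ) (M + N + 1)).exists_bound_of_continuousOn
    Complex.differentiable_one_div_Gamma.continuous.continuousOn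
  have small : ∀ μ : ℂ, ‖μ‖ ≤ M → ∀ k : ℕ, k ≤ N → ‖(Complex.Gamma (μ + k + 1))⁻¹‖ ≤ C := by
    intro μ hμ k hk
    apply hC
    rw [mem_closedBall_zero_iff]
    have h1 : ‖μ + k + 1‖ ≤ ‖μ‖ + ‖(k : ℂ)‖ + ‖(1 : ℂ)‖ := norm_add₃_le
    rw [Complex.norm_natCast, norm_one] at h1
    have : (k : ℝ) ≤ N := by exact_mod_cast hk
    linarith
  refine ⟨max C 0, le_max_right _ _, fun μ hμ k => ?_⟩
  rcases le_total k N with hk | hk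
  · exact (small μ hμ k hk).trans (le_max_left _ _)
  · refine le_trans ?_ (le_max_left _ _)
    induction k, hk using Nat.le_induction with
    | base => exact small μ hμ N le_rfl
    | succ k hk ih =>
      refine le_trans ?_ ih
      rw [Complex.one_div_Gamma_eq_self_mul_one_div_Gamma_add_one (μ + k + 1), norm_mul]
      have h1 : 1 ≤ ‖μ + k + 1‖ := by
        have h2 : ‖((k + 1 : ℕ) : ℂ)‖ ≤ ‖μ + k + 1‖ + ‖μ‖ := by
          have e : ((k + 1 : ℕ) : ℂ) = μ + k + 1 - μ := by push_cast; ring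
          rw [e]
          exact norm_sub_le _ _
        rw [Complex.norm_natCast] at h2
        have : (N : ℝ) ≤ k := by exact_mod_cast hk
        push_cast at h2
        linarith
      push_cast
      rw [← add_assoc]
      exact le_mul_of_one_le_left (norm_nonneg _) h1

theorem exists_norm_besselE_term_le (M : ℝ) :
    ∃ C : ℝ, 0 ≤ C ∧ ∀ μ : ℂ, ‖μ‖ ≤ M → ∀ (N : ℝ) (w : ℂ), ‖w‖ ≤ N → ∀ k : ℕ,
      ‖w ^ k / ((k.factorial : ℂ) * Complex.Gamma (μ + k + 1))‖ ≤ C * (N ^ k / k.factorial) := by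
  obtain ⟨C, hC0, hC⟩ := exists_norm_inv_Gamma_add_nat_le M
  refine ⟨C, hC0, fun μ hμ N w hw k => ?_⟩
  have : w ^ k / ((k.factorial : ℂ) * Complex.Gamma (μ + k + 1))
      = (Complex.Gamma (μ + k + 1))⁻¹ * (w ^ k / (k.factorial : ℂ)) := by
    rw [div_mul_eq_div_div, div_eq_mul_inv, mul_comm]
  rw [this, norm_mul, norm_div, norm_pow, Complex.norm_natCast]
  gcongr
  exact hC μ hμ k

theorem summable_besselE (μ w : ℂ) :
    Summable fun k : ℕ => w ^ k / ((k.factorial : ℂ) * Complex.Gamma (μ + k + 1)) := by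
  obtain ⟨C, -, hC⟩ := exists_norm_besselE_term_le ‖μ‖
  exact Summable.of_norm_bounded ((Real.summable_pow_div_factorial ‖w‖).mul_left C)
    (hC μ le_rfl ‖w‖ w le_rfl)

theorem exists_norm_besselE_le (M N : ℝ) :
    ∃ C : ℝ, ∀ μ w : ℂ, ‖μ‖ ≤ M → ‖w‖ ≤ N → ‖besselE μ w‖ ≤ C := by
  obtain ⟨C, -, hC⟩ := exists_norm_besselE_term_le M
  refine ⟨∑' k : ℕ, C * (N ^ k / k.factorial), fun μ w hμ hw => ?_⟩
  exact tsum_of_norm_bounded ((Real.summable_pow_div_factorial N).mul_left C).hasSum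
    (hC μ hμ N w hw)

theorem differentiable_besselE_order (w : ℂ) : Differentiable ℂ fun μ => besselE μ w := by
  intro μ
  obtain ⟨C, -, hC⟩ := exists_norm_besselE_term_le (‖μ‖ + 1)
  have := Complex.differentiableOn_tsum_of_summable_norm (U := Metric.ball 0 (‖μ‖ + 1))
    (F := fun (k : ℕ) μ => w ^ k / ((k.factorial : ℂ) * Complex.Gamma (μ + k + 1)))
    ((Real.summable_pow_div_factorial ‖w‖).mul_left C) (fun k => ?_) Metric.isOpen_ball
    (fun k ν hν => hC ν (mem_ball_zero_iff.1 hν).le ‖w‖ w le_rfl k)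
  · exact this.differentiableAt (Metric.isOpen_ball.mem_nhds (by simp))
  · have h1 : Differentiable ℂ fun μ : ℂ => (Complex.Gamma (μ + k + 1))⁻¹ :=
      Complex.differentiable_one_div_Gamma.comp (by fun_prop : Differentiable ℂ fun μ : ℂ => μ + k + 1)
    simp_rw [div_mul_eq_div_div, div_eq_mul_inv]
    exact (h1.const_mul _).differentiableOn

theorem hasDerivAt_besselE (μ w : ℂ) : HasDerivAt (besselE μ) (besselE (μ + 1) w) w := by
  obtain ⟨C, -, hC⟩ := exists_norm_besselE_term_le ‖μ‖
  have hu := (Real.summable_pow_div_factorial (‖w‖ + 1)).mul_left C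
  have hd : ∀ k : ℕ, DifferentiableOn ℂ
      (fun w => w ^ k / ((k.factorial : ℂ) * Complex.Gamma (μ + k + 1)))
      (Metric.ball 0 (‖w‖ + 1)) := fun k => by fun_prop
  have hb : ∀ k : ℕ, ∀ v ∈ Metric.ball (0 : ℂ) (‖w‖ + 1),
      ‖v ^ k / ((k.factorial : ℂ) * Complex.Gamma (μ + k + 1))‖
        ≤ C * ((‖w‖ + 1) ^ k / k.factorial) :=
    fun k v hv => hC μ le_rfl _ v (mem_ball_zero_iff.1 hv).le k
  have hw : w ∈ Metric.ball (0 : ℂ) (‖w‖ + 1) := by simp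
  have hD := (Complex.differentiableOn_tsum_of_summable_norm hu hd Metric.isOpen_ball
    hb).differentiableAt (Metric.isOpen_ball.mem_nhds hw)
  have hS := Complex.hasSum_deriv_of_summable_norm hu hd Metric.isOpen_ball hb hw
  have h2 : HasSum (fun k : ℕ => w ^ k / ((k.factorial : ℂ) * Complex.Gamma (μ + 1 + k + 1)))
      (deriv (besselE μ) w) := by
    rw [← hasSum_nat_add_iff' 1] at hS
    convert! hS using 1
    · ext k
      have hk : ((k + 1 : ℕ) : ℂ) ≠ 0 := Nat.cast_ne_zero.2 k.succ_ne_zero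
      simp only [deriv_div_const, deriv_pow_field, Nat.factorial_succ, Nat.add_sub_cancel]
      push_cast at hk ⊢
      rw [show μ + 1 + (k : ℂ) + 1 = μ + (k + 1) + 1 by ring, mul_assoc ((k : ℂ) + 1),
        mul_div_mul_left _ _ hk]
    · simp only [Finset.range_one, Finset.sum_singleton, pow_zero, deriv_const, sub_zero]
      rfl
  rw [show besselE (μ + 1) w = deriv (besselE μ) w from h2.tsum_eq]
  exact hD.hasDerivAt

/-- Compare coefficients: in `1/Γ(s) = s/Γ(s+1)` split `s = (μ + 1) + k`. The factor `k` cancels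
against `k!` and shifts the index. This is Bessel's equation in series form. -/
theorem besselE_eq_add (μ w : ℂ) :
    besselE μ w = (μ + 1) * besselE (μ + 1) w + w * besselE (μ + 2) w := by
  have h0 := (summable_besselE (μ + 1) w).hasSum.mul_left (μ + 1)
  have h1 : HasSum (fun k : ℕ => k * (w ^ k / ((k.factorial : ℂ) * Complex.Gamma (μ + 1 + k + 1))))
      (w * besselE (μ + 2) w) := by
    have h2 := (summable_besselE (μ + 2) w).hasSum.mul_left w
    rw [← hasSum_nat_add_iff' 1]
    convert! h2 using 1
    · ext k
      have hk : ((k + 1 : ℕ) : ℂ) ≠ 0 := Nat.cast_ne_zero.2 k.succ_ne_zero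
      simp only [Nat.factorial_succ]
      push_cast at hk ⊢
      rw [show μ + 1 + ((k : ℂ) + 1) + 1 = μ + 2 + k + 1 by ring, mul_assoc ((k : ℂ) + 1),
        mul_div_assoc', mul_div_mul_left _ _ hk, pow_succ']
      ring
    · simp [besselE]
  refine HasSum.tsum_eq ?_
  convert! h0.add h1 using 1
  ext k
  rw [div_mul_eq_div_div, div_eq_mul_inv _ (Complex.Gamma _),
    Complex.one_div_Gamma_eq_self_mul_one_div_Gamma_add_one (μ + k + 1),
    show μ + 1 + (k : ℂ) + 1 = μ + k + 1 + 1 by ring]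
  rw [div_mul_eq_div_div, div_eq_mul_inv _ (Complex.Gamma _)]
  ring

theorem besselE_neg_nat (n : ℕ) (w : ℂ) : besselE (-n) w = w ^ n * besselE n w := by
  have h2 := (summable_besselE n w).hasSum.mul_left (w ^ n)
  refine HasSum.tsum_eq ?_
  rw [← hasSum_nat_add_iff' n]
  convert! h2 using 1
  · ext k
    have e1 : (-(n : ℂ) + ((k + n : ℕ) : ℂ) + 1) = (k : ℂ) + 1 := by push_cast; ring
    have e2 : ((n : ℂ) + k + 1) = ((k + n : ℕ) : ℂ) + 1 := by push_cast; ring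
    rw [e1, e2, Complex.Gamma_nat_eq_factorial, Complex.Gamma_nat_eq_factorial, pow_add]
    ring
  · rw [Finset.sum_eq_zero, sub_zero]
    · rfl
    intro k hk
    have hk := Finset.mem_range.1 hk
    have : (-(n : ℂ) + k + 1) = -((n - 1 - k : ℕ) : ℂ) := by
      rw [Nat.sub_sub, Nat.cast_sub (by omega)]; push_cast; ring
    rw [this, Complex.Gamma_neg_nat_eq_zero, mul_zero, div_zero]

/-- The recurrences at `μ` and `-μ` make the `w`-derivative of the left side vanish, so it equals
its value at `w = 0`. -/
theorem besselE_wronskian (μ w : ℂ) :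
    -2 * μ * (besselE μ w * besselE (-μ) w) + 2 * w *
      (besselE μ w * besselE (-μ + 1) w - besselE (μ + 1) w * besselE (-μ) w)
      = -2 * μ * ((Complex.Gamma (μ + 1))⁻¹ * (Complex.Gamma (-μ + 1))⁻¹) := by
  have hE : ∀ ν : ℂ, besselE ν 0 = (Complex.Gamma (ν + 1))⁻¹ := fun ν => by
    rw [besselE, tsum_eq_single 0 (fun k hk => by simp [hk])]; simp
  have hd : ∀ v : ℂ, HasDerivAt (fun w => -2 * μ * (besselE μ w * besselE (-μ) w) + 2 * w *
      (besselE μ w * besselE (-μ + 1) w - besselE (μ + 1) w * besselE (-μ) w)) 0 v := by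
    intro v
    have ha := hasDerivAt_besselE μ v
    have ha' := hasDerivAt_besselE (μ + 1) v
    have hb := hasDerivAt_besselE (-μ) v
    have hb' := hasDerivAt_besselE (-μ + 1) v
    have := ((ha.mul hb).const_mul (-2 * μ)).add
      (((hasDerivAt_id v).const_mul 2).mul ((ha.mul hb').sub (ha'.mul hb)))
    refine this.congr_deriv ?_
    have e1 := besselE_eq_add μ v
    have e2 := besselE_eq_add (-μ) v
    rw [show μ + 1 + 1 = μ + 2 by ring, show -μ + 1 + 1 = -μ + 2 by ring]
    simp only [Pi.mul_apply, Pi.sub_apply, id]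
    linear_combination (2 * besselE (-μ) v) * e1 - 2 * besselE μ v * e2
  have := is_const_of_deriv_eq_zero (fun v => (hd v).differentiableAt) (fun v => (hd v).deriv) w 0
  simpa [hE] using this

/-! ### Bessel's equation on the slit plane, and Wronskians at non-integer order. -/

theorem Complex.div_two_mem_slitPlane {z : ℂ} (hz : z ∈ Complex.slitPlane) :
    z / 2 ∈ Complex.slitPlane := by
  rcases hz with h | h
  · left; simpa using h
  · right; simpa using h

theorem hasDerivAt_half_cpow (μ : ℂ) {z : ℂ} (hz : z ∈ Complex.slitPlane) :
    HasDerivAt (fun z : ℂ => (z / 2) ^ μ) (μ / z * (z / 2) ^ μ) z := by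
  have h0 := Complex.slitPlane_ne_zero hz
  have := ((hasDerivAt_id z).div_const 2).cpow_const (c := μ) (Complex.div_two_mem_slitPlane hz)
  refine this.congr_deriv ?_
  simp only [id]
  rw [Complex.cpow_sub _ _ (by simpa using h0), Complex.cpow_one]
  field_simp

theorem hasDerivAt_besselE_neg_sq (μ z : ℂ) :
    HasDerivAt (fun z : ℂ => besselE μ (-(z ^ 2 / 4)))
      (-(z / 2) * besselE (μ + 1) (-(z ^ 2 / 4))) z := by
  have h1 : HasDerivAt (fun z : ℂ => -(z ^ 2 / 4)) (-(z / 2)) z := by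
    refine (((hasDerivAt_pow 2 z).div_const 4).neg).congr_deriv ?_
    simp; ring
  exact ((hasDerivAt_besselE μ _).comp z h1).congr_deriv (by ring)

theorem hasDerivAt_besselJ (μ : ℂ) {z : ℂ} (hz : z ∈ Complex.slitPlane) :
    HasDerivAt (besselJ μ) ((z / 2) ^ μ * (μ * besselE μ (-(z ^ 2 / 4))
      - z ^ 2 / 2 * besselE (μ + 1) (-(z ^ 2 / 4))) / z) z := by
  have h0 := Complex.slitPlane_ne_zero hz
  refine ((hasDerivAt_half_cpow μ hz).mul (hasDerivAt_besselE_neg_sq μ z)).congr_deriv ?_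
  field_simp
  ring

theorem mul_deriv_besselJ (μ : ℂ) {z : ℂ} (hz : z ∈ Complex.slitPlane) :
    z * deriv (besselJ μ) z = (z / 2) ^ μ * (μ * besselE μ (-(z ^ 2 / 4))
      - z ^ 2 / 2 * besselE (μ + 1) (-(z ^ 2 / 4))) := by
  rw [(hasDerivAt_besselJ μ hz).deriv, mul_div_cancel₀ _ (Complex.slitPlane_ne_zero hz)]

/-- `f` is a holomorphic solution of Bessel's equation of order `ν` on the slit plane, written
in the form `(z f')' = (ν² - z²) / z * f`. -/
def IsBesselSolution (ν : ℂ) (f : ℂ → ℂ) : Prop :=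
  ∀ z ∈ Complex.slitPlane, DifferentiableAt ℂ f z ∧
    HasDerivAt (fun w => w * deriv f w) ((ν ^ 2 - z ^ 2) / z * f z) z

theorem IsBesselSolution.differentiableOn {ν : ℂ} {f : ℂ → ℂ} (hf : IsBesselSolution ν f) :
    DifferentiableOn ℂ f Complex.slitPlane :=
  fun z hz => (hf z hz).1.differentiableWithinAt

theorem IsBesselSolution.linear_combination {ν : ℂ} {f g : ℂ → ℂ} (hf : IsBesselSolution ν f)
    (hg : IsBesselSolution ν g) (a b : ℂ) :
    IsBesselSolution ν (fun z => a * f z + b * g z) := by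
  have hd : ∀ z ∈ Complex.slitPlane, HasDerivAt (fun z => a * f z + b * g z)
      (a * deriv f z + b * deriv g z) z := fun z hz =>
    ((hf z hz).1.hasDerivAt.const_mul a).add ((hg z hz).1.hasDerivAt.const_mul b)
  intro z hz
  refine ⟨(hd z hz).differentiableAt, ?_⟩
  have h1 := ((hf z hz).2.const_mul a).add ((hg z hz).2.const_mul b)
  refine (h1.congr_of_eventuallyEq ?_).congr_deriv (by ring)
  filter_upwards [Complex.isOpen_slitPlane.mem_nhds hz] with w hw
  simp only [(hd w hw).deriv, Pi.add_apply]
  ring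

theorem isBesselSolution_besselJ (μ : ℂ) : IsBesselSolution μ (besselJ μ) := by
  intro z hz
  have h0 := Complex.slitPlane_ne_zero hz
  refine ⟨(hasDerivAt_besselJ μ hz).differentiableAt, ?_⟩
  have h1 := (hasDerivAt_half_cpow μ hz).mul
    (((hasDerivAt_besselE_neg_sq μ z).const_mul μ).sub
      (((hasDerivAt_pow 2 z).div_const 2).mul (hasDerivAt_besselE_neg_sq (μ + 1) z)))
  refine (h1.congr_of_eventuallyEq ?_).congr_deriv ?_
  · filter_upwards [Complex.isOpen_slitPlane.mem_nhds hz] with w hw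
    exact mul_deriv_besselJ μ hw
  · change _ = (μ ^ 2 - z ^ 2) / z * ((z / 2) ^ μ * besselE μ (-(z ^ 2 / 4)))
    have e := besselE_eq_add μ (-(z ^ 2 / 4))
    simp only [Pi.mul_apply, Pi.sub_apply]
    rw [show μ + 1 + 1 = μ + 2 by ring]
    field_simp
    push_cast
    linear_combination 4 * z ^ 2 * (z / 2) ^ μ * e

theorem isBesselSolution_besselJ_neg (μ : ℂ) : IsBesselSolution μ (besselJ (-μ)) := by
  have := isBesselSolution_besselJ (-μ)
  rwa [IsBesselSolution, neg_sq] at this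

theorem isBesselSolution_besselYQuot (μ : ℂ) : IsBesselSolution μ (besselYQuot μ) := by
  convert (isBesselSolution_besselJ μ).linear_combination (isBesselSolution_besselJ_neg μ)
    (Complex.cos (μ * Real.pi) / Complex.sin (μ * Real.pi)) (-1 / Complex.sin (μ * Real.pi)) using 1
  ext z
  rw [besselYQuot]
  ring

/-- The powers `(z/2)^{±μ}` cancel, leaving `besselE_wronskian`; the reflection formula turns its
Gamma factors into a sine. -/
theorem besselJ_wronskian (μ : ℂ) (hμ : Complex.sin (μ * Real.pi) ≠ 0) {z : ℂ}
    (hz : z ∈ Complex.slitPlane) :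
    z * (besselJ μ z * deriv (besselJ (-μ)) z - deriv (besselJ μ) z * besselJ (-μ) z)
      = -2 * Complex.sin (μ * Real.pi) / Real.pi := by
  have h0 := Complex.slitPlane_ne_zero hz
  have hμ0 : μ ≠ 0 := by rintro rfl; simp at hμ
  have e1 := mul_deriv_besselJ μ hz
  have e2 := mul_deriv_besselJ (-μ) hz
  have e3 := besselE_wronskian μ (-(z ^ 2 / 4))
  have e4 : (z / 2) ^ μ * (z / 2) ^ (-μ) = 1 := by
    rw [Complex.cpow_neg, mul_inv_cancel₀]
    rw [Ne, Complex.cpow_eq_zero_iff]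
    simp [h0]
  have e5 : -2 * μ * ((Complex.Gamma (μ + 1))⁻¹ * (Complex.Gamma (-μ + 1))⁻¹)
      = -2 * Complex.sin (μ * Real.pi) / Real.pi := by
    have := Complex.Gamma_mul_Gamma_one_sub μ
    rw [Complex.Gamma_add_one μ hμ0, neg_add_eq_sub, ← mul_inv,
      mul_assoc μ (Complex.Gamma μ), this, mul_comm μ (Real.pi : ℂ)]
    rw [mul_comm] at hμ
    have : (Real.pi : ℂ) ≠ 0 := by exact_mod_cast Real.pi_ne_zero
    field_simp
  have : z * (besselJ μ z * deriv (besselJ (-μ)) z - deriv (besselJ μ) z * besselJ (-μ) z)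
      = besselJ μ z * (z * deriv (besselJ (-μ)) z) - (z * deriv (besselJ μ) z) * besselJ (-μ) z := by
    ring
  rw [this, e1, e2, ← e5, ← e3]
  change (z / 2) ^ μ * besselE μ (-(z ^ 2 / 4)) * _
    - _ * ((z / 2) ^ (-μ) * besselE (-μ) (-(z ^ 2 / 4))) = _
  set w := -(z ^ 2 / 4) with hw
  rw [show z ^ 2 / 2 = -2 * w by rw [hw]; ring]
  linear_combination (-2 * μ * (besselE μ w * besselE (-μ) w) + 2 * w *
    (besselE μ w * besselE (-μ + 1) w - besselE (μ + 1) w * besselE (-μ) w)) * e4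

theorem besselYQuot_wronskian (μ : ℂ) (hμ : Complex.sin (μ * Real.pi) ≠ 0) {z : ℂ}
    (hz : z ∈ Complex.slitPlane) :
    z * (besselJ μ z * deriv (besselYQuot μ) z - deriv (besselJ μ) z * besselYQuot μ z)
      = 2 / Real.pi := by
  have h1 : deriv (besselYQuot μ) z = (deriv (besselJ μ) z * Complex.cos (μ * Real.pi)
      - deriv (besselJ (-μ)) z) / Complex.sin (μ * Real.pi) :=
    ((((isBesselSolution_besselJ μ z hz).1.hasDerivAt.mul_const _).sub
      (isBesselSolution_besselJ_neg μ z hz).1.hasDerivAt).div_const _).deriv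
  have h2 := besselJ_wronskian μ hμ hz
  have hpi : (Real.pi : ℂ) ≠ 0 := by exact_mod_cast Real.pi_ne_zero
  rw [h1, besselYQuot]
  field_simp at h2 ⊢
  linear_combination -h2

/-- Makes the numerator of `besselYQuot` vanish at order `n`, so the singularity in the order is
removable. -/
theorem besselJ_neg_nat (n : ℕ) {z : ℂ} (hz : z ≠ 0) :
    besselJ (-n) z = (-1) ^ n * besselJ n z := by
  change (z / 2) ^ (-(n : ℂ)) * besselE (-n) (-(z ^ 2 / 4))
    = (-1) ^ n * ((z / 2) ^ (n : ℂ) * besselE n (-(z ^ 2 / 4)))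
  rw [besselE_neg_nat, Complex.cpow_neg, Complex.cpow_natCast,
    show -(z ^ 2 / 4) = -1 * ((z / 2) * (z / 2)) by ring, mul_pow, mul_pow]
  have : (z / 2) ^ n ≠ 0 := pow_ne_zero _ (by simpa using hz)
  field_simp

/-! ### Integer order: limits in the order. -/

/-- Schwarz lemma, with `2M` bounding `|f - f c|`. -/
theorem Complex.norm_dslope_le_of_norm_le_on_ball {f : ℂ → ℂ} {c μ : ℂ} {ρ M : ℝ}
    (hf : DifferentiableOn ℂ f (Metric.ball c ρ)) (hM : ∀ x ∈ Metric.ball c ρ, ‖f x‖ ≤ M)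
    (hμ : μ ∈ Metric.ball c ρ) : ‖dslope f c μ‖ ≤ 2 * M / ρ := by
  have hc : c ∈ Metric.ball c ρ := Metric.mem_ball_self (Metric.pos_of_mem_ball hμ)
  refine Complex.norm_dslope_le_div_of_mapsTo_ball hf (fun x hx => ?_) hμ
  rw [mem_closedBall_iff_norm]
  linarith [norm_sub_le (f x) (f c), hM x hx, hM c hc]

/-- A family holomorphic in the parameter and locally bounded converges locally uniformly as the
parameter tends to a point. -/
theorem tendstoLocallyUniformlyOn_of_differentiableOn_param {F Q : ℂ → ℂ → ℂ} {c : ℂ} {ρ : ℝ}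
    {U : Set ℂ} (hρ : 0 < ρ) (hU : IsOpen U)
    (hF : ∀ z ∈ U, DifferentiableOn ℂ (fun μ => F μ z) (Metric.ball c ρ))
    (hb : ∀ K ⊆ U, IsCompact K → ∃ M : ℝ, ∀ μ ∈ Metric.ball c ρ, ∀ z ∈ K, ‖F μ z‖ ≤ M)
    (hQ : ∀ μ ∈ Metric.ball c ρ, μ ≠ c → ∀ z ∈ U, Q μ z = F μ z) :
    TendstoLocallyUniformlyOn Q (F c) (𝓝[≠] c) U := by
  rw [tendstoLocallyUniformlyOn_iff_forall_isCompact hU]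
  intro K hKU hK
  obtain ⟨M, hM⟩ := hb K hKU hK
  rw [Metric.tendstoUniformlyOn_iff]
  intro ε hε
  have hlim : Tendsto (fun μ : ℂ => ‖μ - c‖ * (2 * M / ρ)) (𝓝[≠] c) (𝓝 0) := by
    have : ContinuousAt (fun μ : ℂ => ‖μ - c‖ * (2 * M / ρ)) c := by fun_prop
    have h := this.tendsto
    simp only [sub_self, norm_zero, zero_mul] at h
    exact h.mono_left nhdsWithin_le_nhds
  filter_upwards [hlim.eventually (gt_mem_nhds hε), self_mem_nhdsWithin,
    nhdsWithin_le_nhds (Metric.ball_mem_nhds c hρ)] with μ h1 h2 h3 z hz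
  rw [hQ μ h3 h2 z (hKU hz), dist_comm, dist_eq_norm]
  refine lt_of_le_of_lt ?_ h1
  have h4 := Complex.norm_dslope_le_of_norm_le_on_ball (hF z (hKU hz)) (fun x hx => hM x hx z hz) h3
  have h5 := sub_smul_dslope (fun μ => F μ z) c μ
  rw [← h5, norm_smul]
  gcongr

/-- By Weierstrass, first and second derivatives converge too, so the equation passes to the limit.
-/
theorem IsBesselSolution.of_tendstoLocallyUniformlyOn {l : Filter ℂ} [l.NeBot] {ν : ℂ}
    {F : ℂ → ℂ → ℂ} {f : ℂ → ℂ} (hl : l ≤ 𝓝 ν) (hF : ∀ μ, IsBesselSolution μ (F μ))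
    (h : TendstoLocallyUniformlyOn F f l Complex.slitPlane) : IsBesselSolution ν f := by
  have hd : ∀ᶠ μ in l, DifferentiableOn ℂ (F μ) Complex.slitPlane :=
    .of_forall fun μ => (hF μ).differentiableOn
  have hf := h.differentiableOn hd Complex.isOpen_slitPlane
  have h1 := h.deriv hd Complex.isOpen_slitPlane
  have hd1 : ∀ᶠ μ in l, DifferentiableOn ℂ ((deriv ∘ F) μ) Complex.slitPlane :=
    .of_forall fun μ => (hF μ).differentiableOn.deriv Complex.isOpen_slitPlane
  have h2 := h1.deriv hd1 Complex.isOpen_slitPlane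
  intro z hz
  have hzn := Complex.isOpen_slitPlane.mem_nhds hz
  have hprod : ∀ g : ℂ → ℂ, DifferentiableOn ℂ g Complex.slitPlane →
      HasDerivAt (fun w => w * deriv g w) (1 * deriv g z + z * deriv (deriv g) z) z := fun g hg =>
    (hasDerivAt_id z).mul (((hg.deriv Complex.isOpen_slitPlane).differentiableAt hzn).hasDerivAt)
  refine ⟨hf.differentiableAt hzn, (hprod f hf).congr_deriv ?_⟩
  have l1 : Tendsto (fun μ => 1 * deriv (F μ) z + z * deriv (deriv (F μ)) z) l
      (𝓝 (1 * deriv f z + z * deriv (deriv f) z)) :=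
    ((h1.tendsto_at hz).const_mul 1).add ((h2.tendsto_at hz).const_mul z)
  have l2 : Tendsto (fun μ => (μ ^ 2 - z ^ 2) / z * F μ z) l
      (𝓝 ((ν ^ 2 - z ^ 2) / z * f z)) :=
    ((((tendsto_id.mono_left hl).pow 2).sub_const _).div_const _).mul (h.tendsto_at hz)
  refine tendsto_nhds_unique (l1.congr fun μ => ?_) l2
  exact (hprod (F μ) (hF μ).differentiableOn).unique (hF μ z hz).2

theorem exists_norm_besselJ_le {K : Set ℂ} (hK : IsCompact K) (hKs : K ⊆ Complex.slitPlane)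
    (M : ℝ) : ∃ C : ℝ, ∀ μ : ℂ, ‖μ‖ ≤ M → ∀ z ∈ K, ‖besselJ μ z‖ ≤ C := by
  obtain ⟨L, hL⟩ := hK.exists_bound_of_continuousOn (f := fun z => Complex.log (z / 2))
    fun z hz => ((continuousAt_id.div_const 2).clog
      (Complex.div_two_mem_slitPlane (hKs hz))).continuousWithinAt
  obtain ⟨N, hN⟩ := hK.exists_bound_of_continuousOn (f := fun z : ℂ => -(z ^ 2 / 4))
    (by fun_prop)
  obtain ⟨C, hC⟩ := exists_norm_besselE_le M N
  refine ⟨Real.exp (L * M) * C, fun μ hμ z hz => ?_⟩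
  change ‖(z / 2) ^ μ * besselE μ (-(z ^ 2 / 4))‖ ≤ _
  have h0 := Complex.slitPlane_ne_zero (Complex.div_two_mem_slitPlane (hKs hz))
  rw [norm_mul, Complex.cpow_def_of_ne_zero h0]
  gcongr
  · refine (Complex.norm_exp_le_exp_norm _).trans (Real.exp_le_exp.2 ?_)
    rw [norm_mul]
    exact mul_le_mul (hL z hz) hμ (norm_nonneg _) ((norm_nonneg _).trans (hL z hz))
  · exact hC μ _ hμ (hN z hz)

theorem differentiable_besselJ_order {z : ℂ} (hz : z ≠ 0) :
    Differentiable ℂ fun μ => besselJ μ z := by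
  change Differentiable ℂ fun μ => (z / 2) ^ μ * besselE μ (-(z ^ 2 / 4))
  refine Differentiable.mul (fun μ => ?_) (differentiable_besselE_order _)
  exact differentiableAt_id.const_cpow (Or.inl (by simpa using hz))

theorem norm_le_of_mem_ball_one {c μ : ℂ} (h : μ ∈ Metric.ball c 1) : ‖μ‖ ≤ ‖c‖ + 1 := by
  have h1 := norm_le_norm_add_norm_sub' μ c
  rw [mem_ball_iff_norm] at h
  linarith

theorem tendstoLocallyUniformlyOn_besselJ (ν : ℂ) :
    TendstoLocallyUniformlyOn besselJ (besselJ ν) (𝓝[≠] ν) Complex.slitPlane := by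
  refine tendstoLocallyUniformlyOn_of_differentiableOn_param one_pos Complex.isOpen_slitPlane
    (fun z hz => (differentiable_besselJ_order (Complex.slitPlane_ne_zero hz)).differentiableOn)
    (fun K hKs hK => ?_) (fun _ _ _ _ _ => rfl)
  obtain ⟨C, hC⟩ := exists_norm_besselJ_le hK hKs (‖ν‖ + 1)
  exact ⟨C, fun μ hμ => hC μ (norm_le_of_mem_ball_one hμ)⟩

theorem Complex.sin_mul_pi_ne_zero_of_mem_ball {n : ℕ} {μ : ℂ} (h : μ ∈ Metric.ball (n : ℂ) 1)
    (hne : μ ≠ n) : Complex.sin (μ * Real.pi) ≠ 0 := by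
  rw [Ne, Complex.sin_eq_zero_iff]
  rintro ⟨k, hk⟩
  have hpi : (Real.pi : ℂ) ≠ 0 := by exact_mod_cast Real.pi_ne_zero
  have hk := mul_right_cancel₀ hpi hk
  subst hk
  rw [mem_ball_iff_norm] at h
  have h1 : ‖((k - n : ℤ) : ℂ)‖ < 1 := by push_cast; exact h
  rw [Complex.norm_intCast] at h1
  have h2 : |k - (n : ℤ)| < 1 := by exact_mod_cast h1
  rw [Int.abs_lt_one_iff] at h2
  apply hne
  have : k = n := by linarith
  rw [this]; simp

theorem Complex.cos_nat_mul_pi (n : ℕ) : Complex.cos (n * Real.pi) = (-1) ^ n := by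
  exact_mod_cast congrArg ((↑) : ℝ → ℂ) (Real.cos_nat_mul_pi n)

theorem Complex.dslope_sin_mul_pi_ne_zero {n : ℕ} {μ : ℂ} (h : μ ∈ Metric.ball (n : ℂ) 1) :
    dslope (fun μ : ℂ => Complex.sin (μ * Real.pi)) n μ ≠ 0 := by
  by_cases hne : μ = n
  · subst hne
    rw [dslope_same]
    have : HasDerivAt (fun μ : ℂ => Complex.sin (μ * Real.pi))
        (Complex.cos (n * Real.pi) * (1 * Real.pi)) n :=
      ((hasDerivAt_id _).mul_const _).csin
    rw [this.deriv, Complex.cos_nat_mul_pi]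
    simp [Real.pi_ne_zero]
  · intro h0
    have := sub_smul_dslope (fun μ : ℂ => Complex.sin (μ * Real.pi)) n μ
    rw [h0, Complex.sin_nat_mul_pi] at this
    exact Complex.sin_mul_pi_ne_zero_of_mem_ball h hne (by simpa using this.symm)

/-- Numerator and sine both vanish at `μ = n`, and the sine only simply. Replacing each by its
`dslope` at `n` removes the singularity without changing the quotient elsewhere. -/
theorem exists_tendstoLocallyUniformlyOn_besselYQuot (n : ℕ) :
    ∃ f : ℂ → ℂ, TendstoLocallyUniformlyOn besselYQuot f (𝓝[≠] (n : ℂ)) Complex.slitPlane := by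
  set S : ℂ → ℂ := fun μ => Complex.sin (μ * Real.pi) with hS
  set G : ℂ → ℂ → ℂ := fun z μ => besselJ μ z * Complex.cos (μ * Real.pi) - besselJ (-μ) z with hG
  have hSd : Differentiable ℂ S := by fun_prop
  have hGd : ∀ z ∈ Complex.slitPlane, Differentiable ℂ (G z) := fun z hz => by
    have h1 := differentiable_besselJ_order (Complex.slitPlane_ne_zero hz)
    exact (h1.mul (by fun_prop)).sub (h1.comp differentiable_neg)
  have hG0 : ∀ z ∈ Complex.slitPlane, G z n = 0 := fun z hz => by
    simp only [hG]
    rw [besselJ_neg_nat n (Complex.slitPlane_ne_zero hz), Complex.cos_nat_mul_pi]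
    ring
  have hdS : Differentiable ℂ (dslope S n) := by
    rw [← differentiableOn_univ, Complex.differentiableOn_dslope univ_mem]
    exact hSd.differentiableOn
  -- The sine slope has no zero in the unit ball; halving the radius leaves a compact set on which
  -- its inverse is bounded.
  have hsub : Metric.closedBall (n : ℂ) (1 / 2) ⊆ Metric.ball (n : ℂ) 1 :=
    Metric.closedBall_subset_ball (by norm_num)
  have hdSi : ∀ μ ∈ Metric.ball (n : ℂ) 1, DifferentiableAt ℂ (fun μ => (dslope S n μ)⁻¹) μ :=
    fun μ hμ => (hdS μ).fun_inv (Complex.dslope_sin_mul_pi_ne_zero hμ)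
  obtain ⟨H, hH⟩ := (isCompact_closedBall (n : ℂ) (1 / 2)).exists_bound_of_continuousOn
    (f := fun μ => (dslope S n μ)⁻¹) fun μ hμ => (hdSi μ (hsub hμ)).continuousAt.continuousWithinAt
  refine ⟨fun z => dslope (G z) n n * (dslope S n n)⁻¹,
    tendstoLocallyUniformlyOn_of_differentiableOn_param (ρ := 1 / 2) (c := (n : ℂ))
    (F := fun μ z => dslope (G z) n μ * (dslope S n μ)⁻¹)
    (by norm_num) Complex.isOpen_slitPlane ?_ ?_ ?_⟩
  · intro z hz
    refine DifferentiableOn.mul ?_ fun μ hμ =>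
      (hdSi μ (hsub (Metric.ball_subset_closedBall hμ))).differentiableWithinAt
    rw [Complex.differentiableOn_dslope (Metric.ball_mem_nhds _ (by norm_num))]
    exact (hGd z hz).differentiableOn
  · intro K hKs hK
    obtain ⟨C, hC⟩ := exists_norm_besselJ_le hK hKs (‖(n : ℂ)‖ + 1)
    obtain ⟨D, hD⟩ := (isCompact_closedBall (n : ℂ) 1).exists_bound_of_continuousOn
      (f := fun μ : ℂ => Complex.cos (μ * Real.pi)) (by fun_prop)
    refine ⟨2 * (C * D + C) / 1 * H, fun μ hμ z hz => ?_⟩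
    have hμ' := Metric.ball_subset_closedBall hμ
    rw [norm_mul]
    refine mul_le_mul (Complex.norm_dslope_le_of_norm_le_on_ball (hGd z (hKs hz)).differentiableOn
      (fun x hx => ?_) (hsub hμ')) (hH μ hμ') (norm_nonneg _) ?_
    · have hx1 := norm_le_of_mem_ball_one hx
      have b1 := hC x hx1 z hz
      have b2 := hC (-x) (by rwa [norm_neg]) z hz
      have b3 := hD x (Metric.ball_subset_closedBall hx)
      refine (norm_sub_le _ _).trans (add_le_add ?_ b2)
      rw [norm_mul]
      exact mul_le_mul b1 b3 (norm_nonneg _) ((norm_nonneg _).trans b1)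
    · have b1 := (norm_nonneg _).trans (hC n (by linarith) z hz)
      have b3 := (norm_nonneg _).trans (hD n (Metric.mem_closedBall_self zero_le_one))
      positivity
  · intro μ hμ hne z hz
    have hsin := Complex.sin_mul_pi_ne_zero_of_mem_ball
      (hsub (Metric.ball_subset_closedBall hμ)) hne
    have h1 := sub_smul_dslope (G z) n μ
    have h2 := sub_smul_dslope S n μ
    rw [hG0 z hz, sub_zero, smul_eq_mul] at h1
    rw [show S n = 0 from Complex.sin_nat_mul_pi n, sub_zero, smul_eq_mul] at h2
    change G z μ / S μ = _
    rw [← h1, ← h2, mul_div_mul_left _ _ (sub_ne_zero.2 hne), div_eq_mul_inv]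

theorem tendstoLocallyUniformlyOn_besselY_nat (n : ℕ) :
    TendstoLocallyUniformlyOn besselYQuot (besselY n) (𝓝[≠] (n : ℂ)) Complex.slitPlane := by
  obtain ⟨f, hf⟩ := exists_tendstoLocallyUniformlyOn_besselYQuot n
  refine hf.congr_right fun z hz => ?_
  rw [besselY, if_pos ⟨n, by simp⟩]
  exact (hf.tendsto_at hz).limUnder_eq.symm

theorem isBesselSolution_besselY {ν : ℝ} (hν : 0 ≤ ν) : IsBesselSolution ν (besselY ν) := by
  by_cases h : ∃ n : ℤ, (ν : ℂ) = n
  · obtain ⟨m, hm⟩ := h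
    have hm' : ν = m := by exact_mod_cast hm
    obtain ⟨n, rfl⟩ := Int.eq_ofNat_of_zero_le (a := m) (by rw [hm'] at hν; exact_mod_cast hν)
    rw [show (ν : ℂ) = (n : ℂ) by simpa using hm]
    exact .of_tendstoLocallyUniformlyOn nhdsWithin_le_nhds isBesselSolution_besselYQuot
      (tendstoLocallyUniformlyOn_besselY_nat n)
  · have : besselY ν = besselYQuot ν := by ext z; rw [besselY, if_neg h]
    rw [this]
    exact isBesselSolution_besselYQuot _

theorem besselY_wronskian {ν : ℝ} (hν : 0 ≤ ν) {z : ℂ} (hz : z ∈ Complex.slitPlane) :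
    z * (besselJ ν z * deriv (besselY ν) z - deriv (besselJ ν) z * besselY ν z)
      = 2 / Real.pi := by
  by_cases h : ∃ n : ℤ, (ν : ℂ) = n
  · obtain ⟨m, hm⟩ := h
    have hm' : ν = m := by exact_mod_cast hm
    obtain ⟨n, rfl⟩ := Int.eq_ofNat_of_zero_le (a := m) (by rw [hm'] at hν; exact_mod_cast hν)
    rw [show (ν : ℂ) = (n : ℂ) by simpa using hm]
    have hJ := tendstoLocallyUniformlyOn_besselJ n
    have hJ' := hJ.deriv (.of_forall fun μ => (isBesselSolution_besselJ μ).differentiableOn)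
      Complex.isOpen_slitPlane
    have hY := tendstoLocallyUniformlyOn_besselY_nat n
    have hY' := hY.deriv (.of_forall fun μ => (isBesselSolution_besselYQuot μ).differentiableOn)
      Complex.isOpen_slitPlane
    have lim := (((hJ.tendsto_at hz).mul (hY'.tendsto_at hz)).sub
      ((hJ'.tendsto_at hz).mul (hY.tendsto_at hz))).const_mul z
    refine tendsto_nhds_unique lim (tendsto_const_nhds.congr' ?_)
    filter_upwards [self_mem_nhdsWithin,
      nhdsWithin_le_nhds (Metric.ball_mem_nhds (n : ℂ) one_pos)] with μ h2 h3
    exact (besselYQuot_wronskian μ (Complex.sin_mul_pi_ne_zero_of_mem_ball h3 h2) hz).symm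
  · have : besselY ν = besselYQuot ν := by ext z; rw [besselY, if_neg h]
    rw [this]
    refine besselYQuot_wronskian _ (fun h0 => h ?_) hz
    obtain ⟨k, hk⟩ := Complex.sin_eq_zero_iff.1 h0
    exact ⟨k, mul_right_cancel₀ (by exact_mod_cast Real.pi_ne_zero) hk⟩

/-! ### The equation in the logarithmic variable: Gronwall and flux estimates. -/

/-- `u` solves Bessel's equation `u'' = (ν² - l e ^ (2 t)) u` in the logarithmic variable, and `v`
is its derivative. -/
def IsLogBesselPair (ν : ℝ) (l : ℂ) (u v : ℝ → ℂ) : Prop :=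
  ∀ t : ℝ, HasDerivAt u (v t) t ∧ HasDerivAt v (((ν : ℂ) ^ 2 - l * Real.exp (2 * t)) * u t) t

namespace IsLogBesselPair

variable {ν : ℝ} {l : ℂ} {u v : ℝ → ℂ}

theorem sub {u₁ v₁ : ℝ → ℂ} (h : IsLogBesselPair ν l u v) (h₁ : IsLogBesselPair ν l u₁ v₁) :
    IsLogBesselPair ν l (u - u₁) (v - v₁) := fun t =>
  ⟨(h t).1.sub (h₁ t).1, ((h t).2.sub (h₁ t).2).congr_deriv (by simp only [Pi.sub_apply]; ring)⟩

theorem norm_le (h : IsLogBesselPair ν l u v) {a b t : ℝ} (ht : t ∈ Set.Icc a b) :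
    ‖(u t, v t)‖ ≤ ‖(u a, v a)‖ * Real.exp ((1 + ν ^ 2 + ‖l‖ * Real.exp (2 * b)) * (t - a)) := by
  have hd : ∀ s, HasDerivAt (fun s => (u s, v s))
      (v s, ((ν : ℂ) ^ 2 - l * Real.exp (2 * s)) * u s) s := fun s => (h s).1.prodMk (h s).2
  have := norm_le_gronwallBound_of_norm_deriv_right_le (f := fun s => (u s, v s)) (a := a) (b := b)
    (K := 1 + ν ^ 2 + ‖l‖ * Real.exp (2 * b)) (ε := 0)
    (fun s _ => (hd s).continuousAt.continuousWithinAt)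
    (fun s _ => (hd s).hasDerivWithinAt) le_rfl (fun s hs => ?_) t ht
  · rwa [gronwallBound_ε0] at this
  rw [add_zero, Prod.norm_mk, Prod.norm_mk]
  have hk : ‖(ν : ℂ) ^ 2 - l * Real.exp (2 * s)‖ ≤ ν ^ 2 + ‖l‖ * Real.exp (2 * b) := by
    refine (norm_sub_le _ _).trans (add_le_add ?_ ?_)
    · simp
    · rw [norm_mul, Complex.norm_real, Real.norm_eq_abs, Real.abs_exp]
      have := hs.2.le
      gcongr
  have hp : 0 ≤ ν ^ 2 + ‖l‖ * Real.exp (2 * b) := (norm_nonneg _).trans hk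
  have hm : 0 ≤ max ‖u s‖ ‖v s‖ := (norm_nonneg _).trans (le_max_left _ _)
  apply max_le
  · exact (le_max_right _ _).trans (le_mul_of_one_le_left hm (by linarith))
  · rw [norm_mul]
    exact mul_le_mul (by linarith) (le_max_left _ _) (norm_nonneg _) (by linarith)

theorem eq_of_eq {u₁ v₁ : ℝ → ℂ} (h : IsLogBesselPair ν l u v) (h₁ : IsLogBesselPair ν l u₁ v₁)
    {a b : ℝ} (hab : a ≤ b) (hu : u a = u₁ a) (hv : v a = v₁ a) : u b = u₁ b ∧ v b = v₁ b := by
  have := (h.sub h₁).norm_le (Set.right_mem_Icc.2 hab)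
  simp only [Pi.sub_apply, hu, hv, sub_self, Prod.mk_zero_zero, norm_zero, zero_mul,
    norm_le_zero_iff, Prod.mk_eq_zero, sub_eq_zero] at this
  exact this

/-- The cross terms complete the square, so `l` is the only possibly nonreal coefficient and
multiplies a nonnegative weight. -/
theorem hasDerivAt_flux (h : IsLogBesselPair ν l u v) (δ : ℝ) (t : ℝ) :
    HasDerivAt (fun t => (v t - δ * u t) * star (u t))
      (((‖v t - δ * u t‖ ^ 2 + (ν ^ 2 - δ ^ 2) * ‖u t‖ ^ 2 : ℝ) : ℂ)
        - l * ((Real.exp (2 * t) * ‖u t‖ ^ 2 : ℝ) : ℂ)) t := by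
  have h1 := ((h t).2.sub ((h t).1.const_mul (δ : ℂ))).mul (h t).1.star
  refine h1.congr_deriv ?_
  simp only [Pi.sub_apply]
  push_cast
  rw [← Complex.mul_conj' (v t - δ * u t), ← Complex.mul_conj' (u t)]
  simp only [Complex.star_def, map_sub, map_mul, Complex.conj_ofReal]
  ring

end IsLogBesselPair

theorem mul_sub_le_of_hasDerivAt {f f' : ℝ → ℝ} {a s b m : ℝ} (has : a ≤ s) (hsb : s ≤ b)
    (hf : ∀ t, HasDerivAt f (f' t) t) (h0 : ∀ t ∈ Set.Icc a b, 0 ≤ f' t)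
    (hm : ∀ t ∈ Set.Icc a s, m ≤ f' t) : m * (s - a) ≤ f b - f a := by
  have hc : Continuous f := continuous_iff_continuousAt.2 fun t => (hf t).continuousAt
  have hd : Differentiable ℝ f := fun t => (hf t).differentiableAt
  have h1 := (convex_Icc a s).mul_sub_le_image_sub_of_le_deriv hc.continuousOn hd.differentiableOn
    (C := m) (fun t ht => by rw [(hf t).deriv]; exact hm t (interior_subset ht)) a
    (Set.left_mem_Icc.2 has) s (Set.right_mem_Icc.2 has) has
  have h2 := (convex_Icc s b).mul_sub_le_image_sub_of_le_deriv hc.continuousOn hd.differentiableOn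
    (C := 0) (fun t ht => by
      rw [(hf t).deriv]
      exact h0 t ⟨has.trans (interior_subset ht).1, (interior_subset ht).2⟩) s
    (Set.left_mem_Icc.2 hsb) b (Set.right_mem_Icc.2 hsb) hsb
  linarith

/-- Quantitative self-adjointness: away from the non-negative reals the spectral parameter is not
an eigenvalue of the Neumann-type problem, with a bound uniform on bounded sets. -/
theorem IsLogBesselPair.exists_boundary_lower_bound {ν δ a b : ℝ} (hν : |δ| ≤ ν) (hab : a < b)
    {u₀ : ℂ} (hu₀ : u₀ ≠ 0) (M : ℝ) :
    ∃ κ > 0, ∀ (l : ℂ) (u v : ℝ → ℂ), ‖l‖ ≤ M → IsLogBesselPair ν l u v → u a = u₀ →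
      v a = δ * u₀ → ∀ ω : ℂ, ‖ω‖ ≤ 1 → 0 ≤ ω.re → (ω * l).re ≤ 0 →
        κ * -(ω * l).re ≤ ‖v b - δ * u b‖ := by
  -- Gronwall bound for `|u|` and `|v|` on all of `[a, b]`.
  set C : ℝ := ‖(u₀, (δ : ℂ) * u₀)‖ *
    Real.exp ((1 + ν ^ 2 + M * Real.exp (2 * b)) * (b - a)) with hC
  have hu₀' : 0 < ‖u₀‖ := norm_pos_iff.2 hu₀
  have hC0 : 0 < C := by
    have : 0 < ‖(u₀, (δ : ℂ) * u₀)‖ := norm_pos_iff.2 (by simp [hu₀])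
    positivity
  -- Since `|u'| ≤ C`, `|u|` stays above `|u₀|/2` up to this time.
  set s : ℝ := min b (a + ‖u₀‖ / (2 * C)) with hs
  have hsb : s ≤ b := min_le_left _ _
  have has : a < s := lt_min hab (by linarith [show 0 < ‖u₀‖ / (2 * C) by positivity])
  -- Flux gained on `[a, s]` per unit of `-Re (ω l)`, divided by the bound `C` on `|u b|`.
  refine ⟨Real.exp (2 * a) * (‖u₀‖ / 2) ^ 2 * (s - a) / C,
    by have := sub_pos.2 has; positivity, ?_⟩
  intro l u v hl h hua hva ω hω1 hω0 hωl
  have hbound : ∀ t ∈ Set.Icc a b, ‖(u t, v t)‖ ≤ C := fun t ht => by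
    refine (h.norm_le ht).trans ?_
    rw [hua, hva, hC]
    have h1 := ht.1
    have h2 := ht.2
    gcongr
    have : 0 ≤ M := (norm_nonneg _).trans hl
    positivity
  have hlow : ∀ t ∈ Set.Icc a s, ‖u₀‖ / 2 ≤ ‖u t‖ := fun t ht => by
    have h1 := norm_image_sub_le_of_norm_deriv_le_segment' (f := u) (f' := v) (a := a) (b := s)
      (C := C) (fun t _ => (h t).1.hasDerivWithinAt) (fun t ht =>
        (le_max_right ‖u t‖ ‖v t‖).trans (hbound t ⟨ht.1, ht.2.le.trans hsb⟩)) t ht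
    have h2 : t - a ≤ ‖u₀‖ / (2 * C) := by linarith [ht.2, min_le_right b (a + ‖u₀‖ / (2 * C))]
    have h3 : C * (t - a) ≤ ‖u₀‖ / 2 := by
      calc C * (t - a) ≤ C * (‖u₀‖ / (2 * C)) := by gcongr
        _ = ‖u₀‖ / 2 := by field_simp
    rw [hua] at h1
    have h4 := norm_sub_norm_le u₀ (u t)
    rw [norm_sub_rev] at h4
    linarith
  have hδ : 0 ≤ ν ^ 2 - δ ^ 2 := by
    have := sq_le_sq' (by linarith [abs_nonneg δ]) hν
    rw [sq_abs] at this
    linarith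
  have hF : ∀ t, HasDerivAt (fun t => (ω * ((v t - δ * u t) * star (u t))).re)
      (ω.re * (‖v t - δ * u t‖ ^ 2 + (ν ^ 2 - δ ^ 2) * ‖u t‖ ^ 2)
        - (ω * l).re * (Real.exp (2 * t) * ‖u t‖ ^ 2)) t := fun t => by
    have := (Complex.reCLM.hasFDerivAt.comp_hasDerivAt t ((h.hasDerivAt_flux δ t).const_mul ω))
    refine this.congr_deriv ?_
    rw [mul_sub, ← mul_assoc]
    simp only [Complex.reCLM_apply, Complex.sub_re, Complex.re_mul_ofReal]
  have key := mul_sub_le_of_hasDerivAt (m := -(ω * l).re * (Real.exp (2 * a) * (‖u₀‖ / 2) ^ 2))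
    has.le hsb hF (fun t _ => ?_) (fun t ht => ?_)
  · have e0 : (v a - δ * u a) = 0 := by rw [hua, hva, sub_self]
    simp only [e0, zero_mul, mul_zero, Complex.zero_re, sub_zero] at key
    have hB : (ω * ((v b - δ * u b) * star (u b))).re ≤ ‖v b - δ * u b‖ * C := by
      refine (Complex.re_le_norm _).trans ?_
      rw [norm_mul, norm_mul, norm_star]
      calc ‖ω‖ * (‖v b - δ * u b‖ * ‖u b‖) ≤ 1 * (‖v b - δ * u b‖ * C) := by
            gcongr
            exact (le_max_left ‖u b‖ ‖v b‖).trans (hbound b (Set.right_mem_Icc.2 hab.le))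
        _ = _ := one_mul _
    rw [div_mul_eq_mul_div, div_le_iff₀ hC0]
    linarith
  · have : 0 ≤ -(ω * l).re * (Real.exp (2 * t) * ‖u t‖ ^ 2) := mul_nonneg (by linarith) (by positivity)
    have : 0 ≤ ω.re * (‖v t - δ * u t‖ ^ 2 + (ν ^ 2 - δ ^ 2) * ‖u t‖ ^ 2) := by positivity
    linarith
  · have h1 : 0 ≤ ω.re * (‖v t - δ * u t‖ ^ 2 + (ν ^ 2 - δ ^ 2) * ‖u t‖ ^ 2) := by positivity
    have h2 : -(ω * l).re * (Real.exp (2 * a) * (‖u₀‖ / 2) ^ 2)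
        ≤ -(ω * l).re * (Real.exp (2 * t) * ‖u t‖ ^ 2) := by
      have := ht.1
      have := hlow t ht
      have : 0 ≤ -(ω * l).re := by linarith
      gcongr
    linarith

/-! ### The cross product as a boundary defect: evenness and two-sided bounds. -/

theorem Complex.ofReal_mul_mem_slitPlane {x : ℝ} (hx : 0 < x) {z : ℂ}
    (hz : z ∈ Complex.slitPlane) : (x : ℂ) * z ∈ Complex.slitPlane := by
  rcases hz with h | h
  · left
    rw [Complex.re_ofReal_mul]
    exact mul_pos hx h
  · right
    rw [Complex.im_ofReal_mul]
    exact mul_ne_zero hx.ne' h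

theorem IsBesselSolution.isLogBesselPair {ν : ℝ} {f : ℂ → ℂ} (hf : IsBesselSolution ν f) {z : ℂ}
    (hz : z ∈ Complex.slitPlane) :
    IsLogBesselPair ν (z ^ 2) (fun t => f (Real.exp t * z))
      (fun t => Real.exp t * z * deriv f (Real.exp t * z)) := by
  intro t
  have hw : (Real.exp t : ℂ) * z ∈ Complex.slitPlane :=
    Complex.ofReal_mul_mem_slitPlane (Real.exp_pos t) hz
  have hc : HasDerivAt (fun t : ℝ => (Real.exp t : ℂ) * z) (Real.exp t * z) t :=
    (Real.hasDerivAt_exp t).ofReal_comp.mul_const z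
  have h0 := Complex.slitPlane_ne_zero hz
  refine ⟨(((hf _ hw).1.hasDerivAt).scomp t hc).congr_deriv (by rw [smul_eq_mul]), ?_⟩
  refine (((hf _ hw).2).scomp t hc).congr_deriv ?_
  rw [smul_eq_mul, two_mul, Real.exp_add]
  push_cast
  field_simp

/-- Take `b J - a Y`, with `a`, `b` the values of `w f' - δ f` at `w = rz` for `f = J`, `Y`. The
boundary condition at `log r` is then automatic, and the Wronskian removes `z` from the initial
data. -/
theorem exists_isLogBesselPair_cross {r R ν : ℝ} (hr : 0 < r) (hR : 0 < R) (δ : ℝ) (hν : 0 ≤ ν)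
    {z : ℂ} (hz : z ∈ Complex.slitPlane) :
    ∃ u v : ℝ → ℂ, IsLogBesselPair ν (z ^ 2) u v ∧ u (Real.log r) = 2 / Real.pi ∧
      v (Real.log r) = δ * (2 / Real.pi) ∧
      v (Real.log R) - δ * u (Real.log R) =
        R * r * z ^ 2 * (crossG r R ν z + crossE r R ν δ z) := by
  have hrz := Complex.ofReal_mul_mem_slitPlane hr hz
  have hRz := Complex.ofReal_mul_mem_slitPlane hR hz
  set a : ℂ := r * z * deriv (besselJ ν) (r * z) - δ * besselJ ν (r * z) with ha
  set b : ℂ := r * z * deriv (besselY ν) (r * z) - δ * besselY ν (r * z) with hb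
  have hJ := isBesselSolution_besselJ (ν : ℂ)
  have hY := isBesselSolution_besselY hν
  have hder : ∀ w ∈ Complex.slitPlane, deriv (fun z => b * besselJ ν z + (-a) * besselY ν z) w
      = b * deriv (besselJ ν) w + (-a) * deriv (besselY ν) w := fun w hw =>
    (((hJ w hw).1.hasDerivAt.const_mul b).add ((hY w hw).1.hasDerivAt.const_mul (-a))).deriv
  have hW := besselY_wronskian hν hrz
  refine ⟨_, _, (hJ.linear_combination hY b (-a)).isLogBesselPair hz, ?_, ?_, ?_⟩
  · simp only [Real.exp_log hr]
    rw [ha, hb, ← hW]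
    ring
  · simp only [Real.exp_log hr]
    rw [hder _ hrz, ha, hb, ← hW]
    ring
  · simp only [Real.exp_log hR]
    rw [hder _ hRz, ha, hb, crossG, crossE, crossF]
    have h0 := Complex.slitPlane_ne_zero hz
    have hr' : (r : ℂ) ≠ 0 := by exact_mod_cast hr.ne'
    have hR' : (R : ℂ) ≠ 0 := by exact_mod_cast hR.ne'
    generalize besselJ ν (R * z) = j₁
    generalize besselJ ν (r * z) = j₂
    generalize besselY ν (R * z) = y₁
    generalize besselY ν (r * z) = y₂
    generalize deriv (besselJ ν) (R * z) = dj₁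
    generalize deriv (besselJ ν) (r * z) = dj₂
    generalize deriv (besselY ν) (R * z) = dy₁
    generalize deriv (besselY ν) (r * z) = dy₂
    field_simp
    ring

theorem differentiableOn_comp_ofReal_mul {f : ℂ → ℂ} (hf : DifferentiableOn ℂ f Complex.slitPlane)
    {x : ℝ} (hx : 0 < x) : DifferentiableOn ℂ (fun z : ℂ => f (x * z)) Complex.slitPlane :=
  hf.comp (f := fun z : ℂ => (x : ℂ) * z) (by fun_prop)
    fun _ hz => Complex.ofReal_mul_mem_slitPlane hx hz

theorem differentiableOn_cross {r R ν : ℝ} (hr : 0 < r) (hR : 0 < R) (δ : ℝ) (hν : 0 ≤ ν) :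
    DifferentiableOn ℂ (fun z => crossG r R ν z + crossE r R ν δ z) Complex.slitPlane := by
  have hJ := (isBesselSolution_besselJ (ν : ℂ)).differentiableOn
  have hY := (isBesselSolution_besselY hν).differentiableOn
  have hJ' := hJ.deriv Complex.isOpen_slitPlane
  have hY' := hY.deriv Complex.isOpen_slitPlane
  have j₁ := differentiableOn_comp_ofReal_mul hJ hR
  have j₂ := differentiableOn_comp_ofReal_mul hJ hr
  have y₁ := differentiableOn_comp_ofReal_mul hY hR
  have y₂ := differentiableOn_comp_ofReal_mul hY hr
  have dj₁ := differentiableOn_comp_ofReal_mul hJ' hR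
  have dj₂ := differentiableOn_comp_ofReal_mul hJ' hr
  have dy₁ := differentiableOn_comp_ofReal_mul hY' hR
  have dy₂ := differentiableOn_comp_ofReal_mul hY' hr
  have hr' : (r : ℂ) ≠ 0 := by exact_mod_cast hr.ne'
  have hR' : (R : ℂ) ≠ 0 := by exact_mod_cast hR.ne'
  have q₁ : DifferentiableOn ℂ (fun z : ℂ => (δ : ℂ) ^ 2 / (R * r * z ^ 2)) Complex.slitPlane :=
    (differentiableOn_const _).div (by fun_prop) fun z hz =>
      mul_ne_zero (mul_ne_zero hR' hr') (pow_ne_zero _ (Complex.slitPlane_ne_zero hz))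
  have q₂ : DifferentiableOn ℂ (fun z : ℂ => (δ : ℂ) / (R * z)) Complex.slitPlane :=
    (differentiableOn_const _).div (by fun_prop) fun z hz =>
      mul_ne_zero hR' (Complex.slitPlane_ne_zero hz)
  have q₃ : DifferentiableOn ℂ (fun z : ℂ => (δ : ℂ) / (r * z)) Complex.slitPlane :=
    (differentiableOn_const _).div (by fun_prop) fun z hz =>
      mul_ne_zero hr' (Complex.slitPlane_ne_zero hz)
  exact ((dj₁.mul dy₂).sub (dj₂.mul dy₁)).add
    (((q₁.mul ((j₁.mul y₂).sub (j₂.mul y₁))).sub (q₂.mul ((j₁.mul dy₂).sub (dj₂.mul y₁)))).sub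
      (q₃.mul ((dj₁.mul y₂).sub (j₂.mul dy₁))))

/-- The initial value problems for `z` and `-z` coincide, so uniqueness applies. -/
theorem cross_neg {r R ν : ℝ} (hr : 0 < r) (hrR : r < R) (δ : ℝ) (hν : 0 ≤ ν) {z : ℂ}
    (hz : z ∈ Complex.slitPlane) (hz' : -z ∈ Complex.slitPlane) :
    crossG r R ν (-z) + crossE r R ν δ (-z) = crossG r R ν z + crossE r R ν δ z := by
  have hR := hr.trans hrR
  obtain ⟨u, v, h, hu, hv, he⟩ := exists_isLogBesselPair_cross hr hR δ hν hz
  obtain ⟨u₁, v₁, h₁, hu₁, hv₁, he₁⟩ := exists_isLogBesselPair_cross hr hR δ hν hz'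
  rw [neg_sq] at h₁ he₁
  obtain ⟨e1, e2⟩ := h.eq_of_eq h₁ (Real.log_le_log hr hrR.le) (hu.trans hu₁.symm)
    (hv.trans hv₁.symm)
  rw [e1, e2, he₁] at he
  have hr' : (r : ℂ) ≠ 0 := by exact_mod_cast hr.ne'
  have hR' : (R : ℂ) ≠ 0 := by exact_mod_cast hR.ne'
  exact mul_left_cancel₀
    (mul_ne_zero (mul_ne_zero hR' hr') (pow_ne_zero 2 (Complex.slitPlane_ne_zero hz))) he

theorem exists_norm_sq_mul_cross_le {r R ν : ℝ} (hr : 0 < r) (hrR : r < R) (δ : ℝ) (hν : 0 ≤ ν) :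
    ∃ C : ℝ, ∀ z ∈ Complex.slitPlane, ‖z‖ ≤ 1 →
      ‖z ^ 2 * (crossG r R ν z + crossE r R ν δ z)‖ ≤ C := by
  have hR := hr.trans hrR
  have hl := Real.log_le_log hr hrR.le
  refine ⟨(1 + |δ|) * (‖((2 / Real.pi : ℂ), (δ : ℂ) * (2 / Real.pi))‖ *
    Real.exp ((1 + ν ^ 2 + 1 * Real.exp (2 * Real.log R)) * (Real.log R - Real.log r))) / (R * r),
    fun z hz hz1 => ?_⟩
  obtain ⟨u, v, h, hu, hv, he⟩ := exists_isLogBesselPair_cross hr hR δ hν hz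
  have h1 := h.norm_le (Set.right_mem_Icc.2 hl)
  rw [hu, hv] at h1
  rw [le_div_iff₀ (by positivity)]
  have h2 : ‖z ^ 2 * (crossG r R ν z + crossE r R ν δ z)‖ * (R * r)
      = ‖v (Real.log R) - δ * u (Real.log R)‖ := by
    rw [he, mul_assoc ((R : ℂ) * r), norm_mul ((R : ℂ) * r), norm_mul (R : ℂ), Complex.norm_real,
      Complex.norm_real, Real.norm_of_nonneg hr.le, Real.norm_of_nonneg hR.le, mul_comm]
  rw [h2]
  have h3 : ‖v (Real.log R) - δ * u (Real.log R)‖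
      ≤ (1 + |δ|) * ‖(u (Real.log R), v (Real.log R))‖ := by
    refine (norm_sub_le _ _).trans ?_
    rw [norm_mul, Complex.norm_real, Real.norm_eq_abs, add_mul, one_mul]
    gcongr
    · exact le_max_right ‖u (Real.log R)‖ _
    · exact le_max_left _ ‖v (Real.log R)‖
  refine h3.trans ?_
  gcongr
  refine h1.trans ?_
  have h4 : ‖z ^ 2‖ ≤ 1 := by rw [norm_pow]; exact pow_le_one₀ (norm_nonneg _) hz1
  have h5 := sub_nonneg.2 hl
  gcongr

/-- Flux bound with `l = z²`: `ω = ±i` by the sign of `Im z²`, and `ω = 1` on the imaginary axis,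
where `z² ≤ 0`. -/
theorem exists_norm_sq_mul_cross_ge {r R ν δ : ℝ} (hr : 0 < r) (hrR : r < R) (hν : |δ| ≤ ν)
    (M : ℝ) : ∃ κ > 0, ∀ z ∈ Complex.slitPlane, ‖z‖ ≤ M →
      κ * |(z ^ 2).im| ≤ ‖z ^ 2 * (crossG r R ν z + crossE r R ν δ z)‖ ∧
      (z.re = 0 → κ * ‖z ^ 2‖ ≤ ‖z ^ 2 * (crossG r R ν z + crossE r R ν δ z)‖) := by
  have hR := hr.trans hrR
  have hpi : (2 / Real.pi : ℂ) ≠ 0 := by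
    have : (Real.pi : ℂ) ≠ 0 := by exact_mod_cast Real.pi_ne_zero
    exact div_ne_zero two_ne_zero this
  obtain ⟨κ, hκ, H⟩ := IsLogBesselPair.exists_boundary_lower_bound hν (Real.log_lt_log hr hrR)
    hpi (M ^ 2)
  refine ⟨κ / (R * r), by positivity, fun z hz hzM => ?_⟩
  obtain ⟨u, v, h, hu, hv, he⟩ :=
    exists_isLogBesselPair_cross hr hR δ ((abs_nonneg δ).trans hν) hz
  have hl : ‖z ^ 2‖ ≤ M ^ 2 := by rw [norm_pow]; gcongr
  have key := H (z ^ 2) u v hl h hu hv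
  have h2 : ‖v (Real.log R) - δ * u (Real.log R)‖
      = R * r * ‖z ^ 2 * (crossG r R ν z + crossE r R ν δ z)‖ := by
    rw [he, mul_assoc ((R : ℂ) * r), norm_mul ((R : ℂ) * r), norm_mul (R : ℂ), Complex.norm_real,
      Complex.norm_real, Real.norm_of_nonneg hr.le, Real.norm_of_nonneg hR.le]
  rw [h2] at key
  have hRr : 0 < R * r := by positivity
  refine ⟨?_, fun hre => ?_⟩
  · rw [div_mul_eq_mul_div, div_le_iff₀' hRr]
    rcases le_total 0 (z ^ 2).im with h0 | h0
    · have := key Complex.I (by simp) (by simp) (by rw [Complex.I_mul_re]; linarith)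
      rwa [Complex.I_mul_re, neg_neg, ← abs_of_nonneg h0] at this
    · have := key (-Complex.I) (by simp) (by simp)
        (by rw [neg_mul, Complex.neg_re, Complex.I_mul_re]; linarith)
      rwa [neg_mul, Complex.neg_re, Complex.I_mul_re, neg_neg, ← abs_of_nonpos h0] at this
  · rw [div_mul_eq_mul_div, div_le_iff₀' hRr]
    have e : z ^ 2 = ((-(z.im ^ 2) : ℝ) : ℂ) := by
      apply Complex.ext <;> simp [sq, hre]
    have e1 : ‖z ^ 2‖ = -(1 * z ^ 2).re := by
      rw [one_mul, e, Complex.norm_real, Complex.ofReal_re, Real.norm_eq_abs, abs_neg, neg_neg,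
        abs_of_nonneg (sq_nonneg _)]
    rw [e1]
    exact key 1 (by simp) (by simp) (by linarith [norm_nonneg (z ^ 2)])

/-! ### Extension across the cut and to the origin; the zeros. -/

theorem Complex.mem_slitPlane_or_re_neg {z : ℂ} (hz : z ≠ 0) :
    z ∈ Complex.slitPlane ∨ z.re < 0 := by
  by_contra! h
  obtain ⟨h1, h2⟩ := h
  simp only [Complex.mem_slitPlane_iff, not_or, not_lt, not_not] at h1
  exact hz (Complex.ext (le_antisymm h1.1 h2) h1.2)

theorem Complex.neg_mem_slitPlane_of_re_neg {z : ℂ} (hz : z.re < 0) : -z ∈ Complex.slitPlane :=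
  Or.inl (by simpa using hz)

theorem Complex.mem_closure_slitPlane (z : ℂ) : z ∈ closure Complex.slitPlane := by
  have h : Tendsto (fun t : ℝ => z + t * Complex.I) (𝓝[≠] 0) (𝓝 z) := by
    have : Continuous fun t : ℝ => z + t * Complex.I := by fun_prop
    simpa using (this.tendsto 0).mono_left nhdsWithin_le_nhds
  by_cases hz : z.im = 0
  · refine mem_closure_of_tendsto h ?_
    filter_upwards [self_mem_nhdsWithin] with t ht
    right
    simpa [hz] using ht
  · exact subset_closure (Or.inr hz)

section hTilde

variable {r R ν δ : ℝ}

theorem hTilde_of_mem_slitPlane (hr : 0 < r) (hR : 0 < R) (hν : 0 ≤ ν) {z : ℂ}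
    (hz : z ∈ Complex.slitPlane) :
    hTilde r R ν δ z = crossG r R ν z + crossE r R ν δ z :=
  extendFrom_extends (differentiableOn_cross hr hR δ hν).continuousOn z hz

/-- By evenness, the reflected expression is a continuous continuation across the negative axis. -/
theorem hTilde_of_re_neg (hr : 0 < r) (hrR : r < R) (hν : 0 ≤ ν) {z : ℂ} (hz : z.re < 0) :
    hTilde r R ν δ z = crossG r R ν (-z) + crossE r R ν δ (-z) := by
  refine extendFrom_eq (Complex.mem_closure_slitPlane z) ?_
  have hc : ContinuousAt (fun z => crossG r R ν z + crossE r R ν δ z) (-z) :=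
    ((differentiableOn_cross hr (hr.trans hrR) δ hν).differentiableAt
      (Complex.isOpen_slitPlane.mem_nhds (Complex.neg_mem_slitPlane_of_re_neg hz))).continuousAt
  have ht : Tendsto (fun w => crossG r R ν (-w) + crossE r R ν δ (-w)) (𝓝[Complex.slitPlane] z)
      (𝓝 (crossG r R ν (-z) + crossE r R ν δ (-z))) :=
    (hc.tendsto.comp (continuous_neg.tendsto z)).mono_left nhdsWithin_le_nhds
  refine ht.congr' ?_
  filter_upwards [self_mem_nhdsWithin, nhdsWithin_le_nhds
    ((isOpen_lt Complex.continuous_re continuous_const).mem_nhds hz)] with w hw hw'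
  exact cross_neg hr hrR δ hν hw (Complex.neg_mem_slitPlane_of_re_neg hw')

theorem analyticOnNhd_hTilde (hr : 0 < r) (hrR : r < R) (hν : 0 ≤ ν) :
    AnalyticOnNhd ℂ (hTilde r R ν δ) {0}ᶜ := by
  have hd := differentiableOn_cross hr (hr.trans hrR) δ hν
  have ha := hd.analyticOnNhd Complex.isOpen_slitPlane
  intro z hz
  rcases Complex.mem_slitPlane_or_re_neg hz with h | h
  · refine (ha z h).congr ?_
    filter_upwards [Complex.isOpen_slitPlane.mem_nhds h] with w hw
    exact (hTilde_of_mem_slitPlane hr (hr.trans hrR) hν hw).symm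
  · have h1 : AnalyticAt ℂ (fun w => crossG r R ν (-w) + crossE r R ν δ (-w)) z :=
      (ha _ (Complex.neg_mem_slitPlane_of_re_neg h)).comp_of_eq analyticAt_id.neg rfl
    refine h1.congr ?_
    filter_upwards [(isOpen_lt Complex.continuous_re continuous_const).mem_nhds h] with w hw
    exact (hTilde_of_re_neg hr hrR hν hw).symm

/-- Riemann's removable singularity theorem for the bounded function `z² h̃`. -/
theorem meromorphicAt_hTilde_zero (hr : 0 < r) (hrR : r < R) (hν : 0 ≤ ν) :
    MeromorphicAt (hTilde r R ν δ) 0 := by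
  obtain ⟨C, hC⟩ := exists_norm_sq_mul_cross_le hr hrR δ hν
  set f : ℂ → ℂ := fun z => z ^ 2 * hTilde r R ν δ z with hf
  have hball : Metric.ball (0 : ℂ) 1 ∈ 𝓝 0 := Metric.ball_mem_nhds _ one_pos
  have hd := Complex.differentiableOn_update_limUnder_of_bddAbove (f := f) hball
    (fun z hz => ?_) ?_
  · have ha := hd.analyticAt hball
    have hm := (((MeromorphicAt.id (0 : ℂ)).pow 2).inv).mul ha.meromorphicAt
    refine hm.congr ?_
    filter_upwards [self_mem_nhdsWithin] with z hz
    have hz0 : z ≠ 0 := hz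
    simp only [Pi.mul_apply, Pi.inv_apply, Pi.pow_apply, id, Function.update_of_ne hz0, hf]
    field_simp
  · exact (((differentiable_pow 2) z).mul
      (analyticOnNhd_hTilde hr hrR hν z hz.2).differentiableAt).differentiableWithinAt
  · refine ⟨C, ?_⟩
    rintro _ ⟨z, ⟨hz1, hz0⟩, rfl⟩
    have hz1' : ‖z‖ ≤ 1 := (mem_ball_zero_iff.1 hz1).le
    simp only [Function.comp, hf]
    rcases Complex.mem_slitPlane_or_re_neg hz0 with h | h
    · rw [hTilde_of_mem_slitPlane hr (hr.trans hrR) hν h]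
      exact hC z h hz1'
    · rw [hTilde_of_re_neg hr hrR hν h, ← neg_sq]
      exact hC (-z) (Complex.neg_mem_slitPlane_of_re_neg h) (by rwa [norm_neg])

/-- On the imaginary axis near `0`, `|h̃| ≥ κ`, so `h̃` cannot tend to `0`. -/
theorem not_meromorphicOrderAt_hTilde_zero_pos (hr : 0 < r) (hrR : r < R) (hν : |δ| ≤ ν) :
    ¬ 0 < meromorphicOrderAt (hTilde r R ν δ) 0 := by
  intro h
  have hlim := tendsto_zero_of_meromorphicOrderAt_pos h
  obtain ⟨κ, hκ, H⟩ := exists_norm_sq_mul_cross_ge hr hrR hν 1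
  have hpath : Tendsto (fun t : ℝ => (t : ℂ) * Complex.I) (𝓝[≠] 0) (𝓝[≠] 0) := by
    refine tendsto_nhdsWithin_iff.2 ⟨?_, ?_⟩
    · have : Continuous fun t : ℝ => (t : ℂ) * Complex.I := by fun_prop
      simpa using (this.tendsto 0).mono_left nhdsWithin_le_nhds
    · filter_upwards [self_mem_nhdsWithin] with t ht
      simpa using ht
  have hn := (hlim.comp hpath).norm
  rw [norm_zero] at hn
  refine absurd (ge_of_tendsto hn (b := κ) ?_) (not_le.2 hκ)
  filter_upwards [self_mem_nhdsWithin, nhdsWithin_le_nhds (Metric.ball_mem_nhds (0 : ℝ) one_pos)]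
    with t ht ht1
  have ht : t ≠ 0 := ht
  have hs : (t : ℂ) * Complex.I ∈ Complex.slitPlane := Or.inr (by simpa using ht)
  have h1 : ‖(t : ℂ) * Complex.I‖ ≤ 1 := by simpa using (mem_ball_zero_iff.1 ht1).le
  have h2 := (H _ hs h1).2 (by simp)
  rw [← hTilde_of_mem_slitPlane hr (hr.trans hrR) ((abs_nonneg δ).trans hν) hs, norm_mul,
    mul_comm] at h2
  exact le_of_mul_le_mul_left h2
    (norm_pos_iff.2 (pow_ne_zero 2 (Complex.slitPlane_ne_zero hs)))

theorem im_eq_zero_of_hTilde_eq_zero (hr : 0 < r) (hrR : r < R) (hν : |δ| ≤ ν) {z : ℂ}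
    (hz : hTilde r R ν δ z = 0) : z.im = 0 := by
  by_contra him
  have hs : z ∈ Complex.slitPlane := Or.inr him
  obtain ⟨κ, hκ, H⟩ := exists_norm_sq_mul_cross_ge hr hrR hν ‖z‖
  have h1 := H z hs le_rfl
  rw [← hTilde_of_mem_slitPlane hr (hr.trans hrR) ((abs_nonneg δ).trans hν) hs, hz, mul_zero,
    norm_zero] at h1
  have h2 : (z ^ 2).im = 0 := by
    rw [← abs_nonpos_iff]
    exact nonpos_of_mul_nonpos_right h1.1 hκ
  have h3 : z.re = 0 := by
    have : (z ^ 2).im = 2 * (z.re * z.im) := by rw [sq, Complex.mul_im]; ring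
    rw [this] at h2
    simpa [him] using h2
  have h4 : ‖z ^ 2‖ ≤ 0 := nonpos_of_mul_nonpos_right (h1.2 h3) hκ
  exact pow_ne_zero 2 (Complex.slitPlane_ne_zero hs) (norm_le_zero_iff.1 h4)

/-- At `z + it`, `Im` of the square is `2t Re z`, so `|h̃|` is at least a constant times `|t|`;
order two would force `O(t²)`. -/
theorem not_two_le_analyticOrderAt_hTilde (hr : 0 < r) (hrR : r < R) (hν : |δ| ≤ ν) {z : ℂ}
    (hz0 : z ≠ 0) (him : z.im = 0) : ¬ (2 : ℕ) ≤ analyticOrderAt (hTilde r R ν δ) z := by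
  have hν0 := (abs_nonneg δ).trans hν
  have ha := analyticOnNhd_hTilde (δ := δ) hr hrR hν0 z hz0
  rw [natCast_le_analyticOrderAt ha]
  rintro ⟨g, hg, hgz⟩
  obtain ⟨κ, hκ, H⟩ := exists_norm_sq_mul_cross_ge hr hrR hν (‖z‖ + 1)
  have hre : z.re ≠ 0 := fun h => hz0 (Complex.ext h him)
  have hpath : Tendsto (fun t : ℝ => z + t * Complex.I) (𝓝[≠] 0) (𝓝 z) := by
    have : Continuous fun t : ℝ => z + t * Complex.I := by fun_prop
    simpa using (this.tendsto 0).mono_left nhdsWithin_le_nhds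
  have hlim : Tendsto (fun t : ℝ => ‖z + t * Complex.I‖ ^ 2 * (|t| * ‖g (z + t * Complex.I)‖))
      (𝓝[≠] 0) (𝓝 (‖z‖ ^ 2 * (|0| * ‖g z‖))) :=
    (hpath.norm.pow 2).mul (((continuous_abs.tendsto 0).mono_left nhdsWithin_le_nhds).mul
      (hg.continuousAt.tendsto.comp hpath).norm)
  rw [abs_zero, zero_mul, mul_zero] at hlim
  have hpos : 0 < κ * (2 * |z.re|) := by positivity
  refine absurd (ge_of_tendsto hlim (b := κ * (2 * |z.re|)) ?_) (not_le.2 hpos)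
  filter_upwards [self_mem_nhdsWithin, nhdsWithin_le_nhds (Metric.ball_mem_nhds (0 : ℝ) one_pos),
    hpath.eventually hgz] with t ht ht1 hgt
  have ht : t ≠ 0 := ht
  have hs : z + t * Complex.I ∈ Complex.slitPlane := Or.inr (by simpa [him] using ht)
  have h1 : ‖z + t * Complex.I‖ ≤ ‖z‖ + 1 := by
    refine (norm_add_le _ _).trans ?_
    gcongr
    simpa using (mem_ball_zero_iff.1 ht1).le
  have h2 := (H _ hs h1).1
  have e1 : ((z + t * Complex.I) ^ 2).im = 2 * z.re * t := by
    simp [sq, Complex.mul_im, him]; ring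
  rw [← hTilde_of_mem_slitPlane hr (hr.trans hrR) hν0 hs, hgt, e1, add_sub_cancel_left, norm_mul,
    norm_smul, norm_pow, norm_pow, norm_mul (t : ℂ), Complex.norm_I, mul_one, Complex.norm_real,
    Real.norm_eq_abs, abs_mul, abs_mul, abs_two] at h2
  refine le_of_mul_le_mul_left ?_ (abs_pos.2 ht)
  calc |t| * (κ * (2 * |z.re|)) = κ * (2 * |z.re| * |t|) := by ring
    _ ≤ _ := h2
    _ = _ := by ring

end hTilde

theorem theorem3p2 (r R : ℝ) (hr : 0 < r) (hrR : r < R) (δ ν : ℝ) (hν : |δ| ≤ ν) :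
    AnalyticOnNhd ℂ (hTilde r R ν δ) {0}ᶜ ∧
    MeromorphicAt (hTilde r R ν δ) 0 ∧
    (∀ z ∈ Complex.slitPlane, hTilde r R ν δ z = crossG r R ν z + crossE r R ν δ z) ∧
    ∀ z : ℂ, 0 < meromorphicOrderAt (hTilde r R ν δ) z →
      z.im = 0 ∧ meromorphicOrderAt (hTilde r R ν δ) z = 1 := by
  have hν0 := (abs_nonneg δ).trans hν
  refine ⟨analyticOnNhd_hTilde hr hrR hν0, meromorphicAt_hTilde_zero hr hrR hν0,
    fun z hz => hTilde_of_mem_slitPlane hr (hr.trans hrR) hν0 hz, fun z hz => ?_⟩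
  have hz0 : z ≠ 0 := by
    rintro rfl
    exact not_meromorphicOrderAt_hTilde_zero_pos hr hrR hν hz
  have ha := analyticOnNhd_hTilde (δ := δ) hr hrR hν0 z hz0
  have hval : hTilde r R ν δ z = 0 :=
    tendsto_nhds_unique (ha.continuousAt.tendsto.mono_left nhdsWithin_le_nhds)
      (tendsto_zero_of_meromorphicOrderAt_pos hz)
  have him := im_eq_zero_of_hTilde_eq_zero hr hrR hν hval
  refine ⟨him, ?_⟩
  have h2 := not_two_le_analyticOrderAt_hTilde hr hrR hν hz0 him
  rw [ha.meromorphicOrderAt_eq] at hz ⊢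
  generalize analyticOrderAt (hTilde r R ν δ) z = n at hz h2
  cases n with
  -- Infinite order, that is, vanishing near `z`, is excluded by the same bound.
  | top => exact absurd le_top h2
  | coe n =>
    have h3 : n < 2 := by
      rw [Nat.cast_le] at h2
      omega
    have h4 : n ≠ 0 := by
      rintro rfl
      simp at hz
    obtain rfl : n = 1 := by omega
    rfl
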